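/- Let $T$ be a complete first-order theory in a language $L$ which is dependent (no formula has the independence property in a model of $T$), let $\mathfrak C$ be a model of $T$ (for instance a monster model), let $\kappa$ be a regular uncountable cardinal and let $n<\omega$. For $\ell<n$ let $\mathcal D_\ell$ be a proper filter on a set $I_\ell$, and assume that $\mathcal D_\ell$ is $\kappa$-complete (closed under intersections of fewer than $\kappa$ members) whenever $0<\ell<n$. For $\ell<n$ let $m(\ell)<\omega$ and let $\bar e^\ell_s\in{}^{m(\ell)}\mathfrak C$ for $s\in I_\ell$. Let $\Delta$ be a finite set of $L$-formulas $\varphi(\bar x,\bar y)$ with $\bar x$ of length $m(0)+\dots+m(n-1)$ and $\bar y$ a finite tuple of variables (whose length may depend on $\varphi$), and let $C\subseteq\mathfrak C$ be finite. For a tuple $\bar d$ of the length of $\bar x$ put $$\mathrm{tp}_\Delta(\bar d,C)=\{\varphi(\bar x,\bar c):\varphi(\bar x,\bar y)\in\Delta,\ \bar c\text{ a tuple from }C\text{ of the length of }\bar y,\ \mathfrak C\models\varphi[\bar d,\bar c]\};$$ the sets of this form are the $\Delta$-types over $C$. Call $\mathcal S\subseteq I_\ell$ $\mathcal D_\ell$-positive,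 in symbols $\mathcal S\in\mathcal D_\ell^+$, if $I_\ell\setminus\mathcal S\notin\mathcal D_\ell$, and let $(\forall^{\mathcal D_\ell}s\in\mathcal S)\,\vartheta(s)$ mean that $\{s\in I_\ell: s\in\mathcal S\Rightarrow\vartheta(s)\}\in\mathcal D_\ell$. Then there are a $\Delta$-type $q$ over $C$ and sets $\mathcal S_\ell\in\mathcal D_\ell^+$ for $\ell<n$ such that $$(\forall^{\mathcal D_0}s_0\in\mathcal S_0)(\forall^{\mathcal D_1}s_1\in\mathcal S_1)\cdots(\forall^{\mathcal D_{n-1}}s_{n-1}\in\mathcal S_{n-1})\ \bigl[\,q=\mathrm{tp}_\Delta(\bar e^0_{s_0}{}^\frown\bar e^1_{s_1}{}^\frown\cdots{}^\frown\bar e^{n-1}_{s_{n-1}},\,C)\,\bigr].$$ -/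

import Mathlib

universe u v w x

namespace PolarizedPartition

/-- A formula `φ(x̄, ȳ)` of `L` with a fixed splitting of its free variables into an object
tuple `x̄` of length `m` and a parameter tuple `ȳ` of some finite length. -/
abbrev SplitFormula (L : FirstOrder.Language.{u, v}) (m : ℕ) :=
  Σ k : ℕ, L.Formula (Fin m ⊕ Fin k)

/-- `φ(x̄, ȳ)` has the independence property in the structure `M`: for every `r` there are
`b̄_0, …, b̄_{r-1}` such that every Boolean combination of `φ(x̄, b̄_0), …, φ(x̄, b̄_{r-1})`
which chooses, for each `i`, one of `φ(x̄, b̄_i)` and its negation, is realized in `M`. -/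
def HasIndependenceProperty {L : FirstOrder.Language.{u, v}} (M : Type w) [L.Structure M] {m k : ℕ}
    (φ : L.Formula (Fin m ⊕ Fin k)) : Prop :=
  ∀ r : ℕ, ∃ b : Fin r → Fin k → M, ∀ A : Set (Fin r), ∃ a : Fin m → M,
    ∀ i : Fin r, φ.Realize (Sum.elim a (b i)) ↔ i ∈ A

/-- The theory `T` is dependent (NIP): no formula has the independence property in a model
of `T`. By the Löwenheim–Skolem theorem nothing changes when models in
other universes are considered too. -/
def IsDependent {L : FirstOrder.Language.{u, v}} (T : L.Theory) : Prop :=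
  ∀ (M : FirstOrder.Language.Theory.ModelType.{u, v, max u v} T) (m k : ℕ)
    (φ : L.Formula (Fin m ⊕ Fin k)), ¬ HasIndependenceProperty M φ

/-- `tp_Δ(d̄, C)`: the set of all instances `φ(x̄, c̄)`, with `φ(x̄, ȳ) ∈ Δ` and `c̄` a tuple
from `C`, that `d̄` satisfies in `M`. The instance `φ(x̄, c̄)` is coded by `φ` and `c̄`. -/
def deltaType {L : FirstOrder.Language.{u, v}} {M : Type w} [L.Structure M] {m : ℕ}
    (Δ : Set (SplitFormula L m)) (C : Set M) (d : Fin m → M) :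
    Set (Σ k : ℕ, L.Formula (Fin m ⊕ Fin k) × (Fin k → M)) :=
  {p | (⟨p.1, p.2.1⟩ : SplitFormula L m) ∈ Δ ∧ (∀ j, p.2.2 j ∈ C) ∧
    p.2.1.Realize (Sum.elim d p.2.2)}

/-- The concatenation `e⁰ ⌢ e¹ ⌢ … ⌢ eⁿ⁻¹` of `n` tuples of lengths `m 0, …, m (n-1)`. -/
def concat {M : Type w} {n : ℕ} {m : Fin n → ℕ} (e : ∀ ℓ : Fin n, Fin (m ℓ) → M) :
    Fin (∑ ℓ, m ℓ) → M :=
  fun i => e (finSigmaFinEquiv.symm i).1 (finSigmaFinEquiv.symm i).2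

/-- `S ∈ D⁺`: the complement of `S` is not in `D`. -/
def IsPositive {I : Type x} (D : Filter I) (S : Set I) : Prop :=
  Sᶜ ∉ D

/-- The iterated quantifier
`(∀^{D 0} s₀ ∈ S 0) (∀^{D 1} s₁ ∈ S 1) … (∀^{D (n-1)} sₙ₋₁ ∈ S (n-1)) P ⟨s₀, …, sₙ₋₁⟩`,
where `(∀^D s ∈ S) Q s` says that the set of `s` with `s ∈ S → Q s` belongs to `D`. -/
def IteratedAlmostAll : {n : ℕ} → {I : Fin n → Type x} → (∀ ℓ, Filter (I ℓ)) →
    (∀ ℓ, Set (I ℓ)) → ((∀ ℓ, I ℓ) → Prop) → Prop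
  | 0, _, _, _, P => P (fun ℓ => ℓ.elim0)
  | _ + 1, _, D, S, P => ∀ᶠ s in D 0, s ∈ S 0 →
      IteratedAlmostAll (fun ℓ => D ℓ.succ) (fun ℓ => S ℓ.succ) (fun t => P (Fin.cons s t))

end PolarizedPartition

namespace PolarizedPartition

/-! Call a relation between a parameter `p` and tuples `s_0, ..., s_{n-1}` dense if on every
positive rectangle, for almost every `p`, it holds for positively many `s_0`, then positively many
`s_1`, and so on. Over a one-point parameter space, failure of density for one sign of a formula
says that the opposite sign holds almost everywhere on some positive rectangle. So for a single
formula it suffices that the two signs are not both dense (`not_forall_eventually_rectFrequently`);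
finitely many instances follow by shrinking the rectangle.

If both signs were dense, absorb `s_0` into the parameter and induct on `n`. The new parameter
filter is generated by the sets of pairs at which a sign is still frequent on a rectangle of the
remaining tuples; the point is that this filter is proper (`exists_eventually_rectFrequently`).
Otherwise frequent truth and its failure would both be dense among pairs. One could then build a box
of `E` cells with `L` parameters per cell, such that every choice of one parameter per cell is cut
out by an array of tuples, each entry ignoring the coordinate of its own level
(`exists_config_of_frequently`). This gives `L ^ E` truth patterns over `E * L` parameters.

Dependence forbids this: an entry shared by a whole line of cells has only polynomially many types
over a finite set. Hence on a suitable box the number of patterns over `N` parameters is at most `(B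
* (N + 1)) ^ (E / 2)` (`exists_ncard_range_pattern_pow_le`), which is too few for large `L`. -/

open FirstOrder FirstOrder.Language

/-! ### Shattering and the Sauer–Shelah bound -/

/-- `R` shatters some family of `r` points: every subset of the index set is cut out by `R`. -/
def Shatters {X : Type*} {Y : Type*} (R : X → Y → Prop) (r : ℕ) : Prop :=
  ∃ b : Fin r → X, ∀ A : Set (Fin r), ∃ y, ∀ i, R (b i) y ↔ i ∈ A

/-- A set of at most `v` points is listed by a partial map from `Fin v`. -/
theorem card_finset_card_le {X : Type*} [Fintype X] (v : ℕ)
    (𝒜 : Finset (Finset X)) (h : ∀ s ∈ 𝒜, s.card ≤ v) :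
    𝒜.card ≤ (Fintype.card X + 1) ^ v := by
  classical
  have key : 𝒜.card ≤ (Finset.univ : Finset (Fin v → Option X)).card := by
    refine Finset.card_le_card_of_surjOn
      (fun f => Finset.univ.filter fun a => ∃ i, f i = some a) ?_
    intro s hs
    have hc := h s hs
    refine ⟨fun i => if hi : (i : ℕ) < s.card then some (s.equivFin.symm ⟨i, hi⟩) else none,
      by simp, ?_⟩
    ext a
    simp only [Finset.mem_filter, Finset.mem_univ, true_and]
    constructor
    · rintro ⟨i, hi⟩
      split_ifs at hi with h1
      rw [Option.some.injEq] at hi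
      rw [← hi]
      exact (s.equivFin.symm _).2
    · intro ha
      have h1 := (s.equivFin ⟨a, ha⟩).2
      refine ⟨⟨s.equivFin ⟨a, ha⟩, by omega⟩, ?_⟩
      simp
  simpa using key

/-- The Sauer–Shelah lemma for relations. -/
theorem ncard_range_le_of_not_shatters {X : Type*} {Y : Type*} {R : X → Y → Prop} {v : ℕ}
    (h : ¬ Shatters R (v + 1)) {ι : Type*} [Fintype ι] (c : ι → X) :
    (Set.range fun (y : Y) (i : ι) => R (c i) y).ncard ≤ (Fintype.card ι + 1) ^ v := by
  classical
  set P : Set (ι → Prop) := Set.range fun (y : Y) (i : ι) => R (c i) y with hP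
  let 𝒜 : Finset (Finset ι) :=
    Finset.univ.filter fun s => ∃ y, ∀ i, i ∈ s ↔ R (c i) y
  have h1 : P.ncard ≤ (𝒜 : Set (Finset ι)).ncard := by
    refine Set.ncard_le_ncard_of_injOn (fun p => Finset.univ.filter p) ?_ ?_ (Finset.finite_toSet _)
    · rintro p ⟨y, rfl⟩
      simp only [𝒜, Finset.coe_filter, Finset.mem_univ, true_and, Set.mem_ofPred_eq]
      exact ⟨y, fun i => by simp⟩
    · intro p _ q _ hpq
      funext i
      have := congrArg (fun s => i ∈ s) hpq
      simpa using this
  rw [Set.ncard_coe_finset] at h1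
  refine h1.trans ((Finset.card_le_card_shatterer 𝒜).trans (card_finset_card_le v _ ?_))
  intro s hs
  rw [Finset.mem_shatterer] at hs
  by_contra hlt
  push Not at hlt
  obtain ⟨s', hs', hc⟩ := Finset.exists_subset_card_eq (Nat.succ_le_of_lt hlt)
  have hs2 := hs.mono_right hs'
  let e := (Finset.equivFinOfCardEq hc).symm
  refine h ⟨fun i => c (e i), fun A => ?_⟩
  obtain ⟨u, hu, hu2⟩ := hs2 (t := s'.filter fun a => ∃ i ∈ A, ((e i : s') : ι) = a)
    (Finset.filter_subset _ _)
  simp only [𝒜, Finset.mem_filter, Finset.mem_univ, true_and] at hu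
  obtain ⟨y, hy⟩ := hu
  refine ⟨y, fun i => ?_⟩
  rw [← hy]
  have h3 : ((e i : s') : ι) ∈ s' := (e i).2
  have h4 := congrArg (fun s => ((e i : s') : ι) ∈ s) hu2
  simp only [Finset.mem_inter, h3, true_and, Finset.mem_filter, eq_iff_iff] at h4
  rw [h4]
  constructor
  · rintro ⟨j, hj, hji⟩
    have : j = i := e.injective (Subtype.ext hji)
    exact this ▸ hj
  · exact fun hi => ⟨i, hi, rfl⟩

/-! ### Counting truth patterns on boxes -/

/-- A point of a tower: a base tuple of length `a`, followed by tuples whose lengths are listed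
from last to first. -/
def Tower (M : Type w) (a : ℕ) : List ℕ → Type w
  | [] => Fin a → M
  | m :: t => Tower M a t × (Fin m → M)

/-- The side lengths of a box, one for the base and one for each level of the tower. -/
def Size : List ℕ → Type
  | [] => ℕ
  | _ :: t => Size t × ℕ

/-- The cells of a box. -/
def Cell : (t : List ℕ) → Size t → Type
  | [], r => Fin r
  | _ :: t, s => Cell t s.1 × Fin s.2

instance Cell.finite : ∀ (t : List ℕ) (s : Size t), Finite (Cell t s)
  | [], r => @Finite.of_fintype (Fin r) (Fin.fintype r)
  | _ :: t, s =>
    have := Cell.finite t s.1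
    show Finite (Cell t s.1 × Fin s.2) from inferInstance

noncomputable instance Cell.fintype (t : List ℕ) (s : Size t) : Fintype (Cell t s) :=
  Fintype.ofFinite _

/-- The size of a one-dimensional box. -/
def Size.nil (r : ℕ) : Size [] := r

/-- The size of a box with one more level. -/
def Size.cons {t : List ℕ} (m : ℕ) (s : Size t) (r : ℕ) : Size (m :: t) := (s, r)

theorem Cell.card_nil (r : ℕ) : Fintype.card (Cell [] (Size.nil r)) = r := by
  rw [← Nat.card_eq_fintype_card]
  exact Nat.card_fin r

theorem Cell.card_cons {t : List ℕ} (m : ℕ) (s : Size t) (r : ℕ) :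
    Fintype.card (Cell (m :: t) (Size.cons m s r)) = Fintype.card (Cell t s) * r := by
  rw [← Nat.card_eq_fintype_card, ← Nat.card_eq_fintype_card]
  exact (Nat.card_prod (Cell t s) (Fin r)).trans (by rw [Nat.card_fin])

/-- An array of tower points indexed by the cells of a box, such that the entry of each level does
not depend on the coordinate of that level. -/
def Config (M : Type w) (a : ℕ) : (t : List ℕ) → Size t → Type w
  | [], _ => Fin a → M
  | m :: t, s => (Fin s.2 → Config M a t s.1) × (Cell t s.1 → Fin m → M)

/-- The tower point of a configuration at a cell. -/
def Config.eval {M : Type w} {a : ℕ} :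
    (t : List ℕ) → (s : Size t) → Config M a t s → Cell t s → Tower M a t
  | [], _, f, _ => f
  | _ :: t, s, f, e => (Config.eval t s.1 (f.1 e.2) e.1, f.2 e.1)

/-- The relation induced on tuples of tower points by existentially quantifying the last level of
a positive or negative combination of `r` instances of `φ`. -/
def consistency {M : Type w} {a m : ℕ} {t : List ℕ} {T F : Type} {K : Type w}
    (φ : F → K → (T → Tower M a (m :: t)) → Prop) (n r : ℕ)
    (g : Fin n → F × Fin r × Bool) (k : Fin n → K) (y : T × Fin r → Tower M a t) : Prop :=
  ∃ z : T → Fin m → M, ∀ j,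
    φ (g j).1 (k j) (fun i => (y (i, (g j).2.1), z i)) ↔ (g j).2.2 = true

/-- A relation on tuples of tower points is tame if it shatters only bounded families, at every
level of the tower. -/
def Tame (M : Type w) (a : ℕ) : (t : List ℕ) → (T F : Type) → (K : Type w) →
    (F → K → (T → Tower M a t) → Prop) → Prop
  | [], _, F, K, φ => ∃ v, ¬ Shatters (fun (p : F × K) y => φ p.1 p.2 y) (v + 1)
  | m :: t, T, F, K, φ => ∃ v,
      ¬ Shatters (fun (p : F × K × (T → Tower M a t)) (z : T → Fin m → M) =>
        φ p.1 p.2.1 fun i => (p.2.2 i, z i)) (v + 1) ∧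
      ∀ r, Tame M a t (T × Fin r) (Fin (v + 1) → F × Fin r × Bool) (Fin (v + 1) → K)
        (consistency φ (v + 1) r)

/-- The truth values of the relation `φ` with parameters `c` along tuples of configurations. -/
def pattern {M : Type w} {a : ℕ} {t : List ℕ} {T F : Type} {K : Type w}
    (φ : F → K → (T → Tower M a t) → Prop) (s : Size t) {ι : Type} (c : ι → K)
    (f : T → Config M a t s) : Cell t s → F → ι → Prop :=
  fun e g i => φ g (c i) fun j => Config.eval t s (f j) e

/-- The top tuple is shared by the `r` cells over a lower cell. Record, for the lower levels, which
systems of `v + 1` signed instances are consistent. Given the record, the truth values over each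
lower cell range over a family that Sauer–Shelah bounds. -/
theorem ncard_range_pattern_cons_le {M : Type w} {a m : ℕ} {t : List ℕ} {T F : Type}
    [Finite T] [Fintype F] {K : Type w}
    {φ : F → K → (T → Tower M a (m :: t)) → Prop} {v : ℕ}
    (hv : ¬ Shatters (fun (p : F × K × (T → Tower M a t)) (z : T → Fin m → M) =>
        φ p.1 p.2.1 fun i => (p.2.2 i, z i)) (v + 1))
    (s : Size t) (r : ℕ) {ι : Type} [Fintype ι] (c : ι → K) :
    (Set.range (pattern (t := m :: t) φ (Size.cons m s r) c)).ncard ≤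
      (Set.range (pattern (consistency φ (v + 1) r) s
        fun q : Fin (v + 1) → ι => c ∘ q)).ncard *
      ((Fintype.card F * Fintype.card ι * r + 1) ^ v) ^ Fintype.card (Cell t s) := by
  classical
  let N := (Fin (v + 1) → F × Fin r × Bool) → (Fin (v + 1) → ι) → Prop
  let ℬ : N → Finset (F × ι × Fin r → Prop) := fun h => Finset.univ.filter fun B =>
    ∀ q : Fin (v + 1) → F × ι × Fin r,
      h (fun l => ((q l).1, (q l).2.2, decide (B (q l)))) (fun l => (q l).2.1)
  set Q := Set.range (pattern (consistency φ (v + 1) r) s fun q : Fin (v + 1) → ι => c ∘ q)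
  let asm : (Cell t s → F × ι × Fin r → Prop) → (Cell (m :: t) (Size.cons m s r) → F → ι → Prop) :=
    fun B e g j => B e.1 (g, j, e.2)
  have hQ : Q.Finite := Set.toFinite _
  have hsub : Set.range (pattern (t := m :: t) φ (Size.cons m s r) c) ⊆
      ((hQ.toFinset.biUnion fun H => (Fintype.piFinset fun e => ℬ (H e)).image asm :
        Finset _) : Set (Cell (m :: t) (Size.cons m s r) → F → ι → Prop)) := by
    rintro _ ⟨f, rfl⟩
    simp only [Finset.coe_biUnion, Set.mem_iUnion, Finset.mem_coe, Finset.mem_image,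
      Set.Finite.mem_toFinset, Fintype.mem_piFinset]
    refine ⟨pattern (consistency φ (v + 1) r) s (fun q : Fin (v + 1) → ι => c ∘ q)
      (fun p => (f p.1).1 p.2), ⟨_, rfl⟩,
      fun e p => φ p.1 (c p.2.1) fun i => (Config.eval t s ((f i).1 p.2.2) e, (f i).2 e),
      fun e => ?_, rfl⟩
    simp only [ℬ, Finset.mem_filter, Finset.mem_univ, true_and]
    intro q
    exact ⟨fun i => (f i).2 e, fun l => by simp⟩
  have hB : ∀ H ∈ Q, ∀ e, (ℬ (H e)).card ≤
      (Fintype.card F * Fintype.card ι * r + 1) ^ v := by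
    rintro _ ⟨f, rfl⟩ e
    set h := pattern (consistency φ (v + 1) r) s (fun q : Fin (v + 1) → ι => c ∘ q) f e
    have h1 := ncard_range_le_of_not_shatters
      (R := fun (p : F × ι × Fin r) (B : {B // B ∈ ℬ h}) => B.1 p) (v := v) ?_ id
    · have h2 : (Set.range fun (B : {B // B ∈ ℬ h}) (i : F × ι × Fin r) => B.1 (id i)) =
          (ℬ h : Set _) := by
        ext B
        simp
      rw [h2, Set.ncard_coe_finset] at h1
      simpa [mul_assoc] using h1
    · rintro ⟨b, hb⟩
      -- If the family shattered `v + 1` points, every sign pattern on them would be consistent by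
      -- the record and so have a genuine witness `z`; then `φ` would shatter them.
      refine hv ⟨fun l => ((b l).1, c (b l).2.1,
        fun i => Config.eval t s (f (i, (b l).2.2)) e), fun A => ?_⟩
      obtain ⟨⟨B, hBm⟩, hBA⟩ := hb A
      simp only [ℬ, Finset.mem_filter, Finset.mem_univ, true_and] at hBm
      obtain ⟨z, hz⟩ := hBm b
      refine ⟨z, fun i => ?_⟩
      rw [← hBA i]
      simpa using hz i
  refine (Set.ncard_le_ncard hsub (Finset.finite_toSet _)).trans ?_
  rw [Set.ncard_coe_finset, Set.ncard_eq_toFinset_card Q hQ]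
  refine Finset.card_biUnion_le_card_mul _ _ _ fun H hH => Finset.card_image_le.trans ?_
  rw [Fintype.card_piFinset]
  refine (Finset.prod_le_pow_card _ _ _ fun e _ => hB H (hQ.mem_toFinset.1 hH) e).trans ?_
  simp

/-- Lengthening a side multiplies the cells but adds no entries on its own level, so the exponent
can be pushed down to a `1 / p` fraction of the number of cells. The box and `B` do not depend on
`ι`, so the number of parameters can be fixed afterwards. -/
theorem exists_ncard_range_pattern_pow_le {M : Type w} {a : ℕ} (p : ℕ) :
    ∀ (t : List ℕ) (T F : Type) [Finite T] [Fintype F] (K : Type w)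
      (φ : F → K → (T → Tower M a t) → Prop), Tame M a t T F K φ →
      ∃ s : Size t, 1 ≤ Fintype.card (Cell t s) ∧ ∃ B ≥ 1, ∀ (ι : Type) [Fintype ι] (c : ι → K),
        (Set.range (pattern φ s c)).ncard ^ p ≤
          (B * (Fintype.card ι + 1)) ^ Fintype.card (Cell t s)
  | [], T, F, _, _, K, φ, h => by
    obtain ⟨v, hv⟩ := h
    -- All cells carry the same tuple, so the exponent `v * p` only has to fit into the number of
    -- cells; the extra cell keeps the box nonempty.
    have hc := Cell.card_nil (v * p + 1)
    refine ⟨Size.nil (v * p + 1), by simp [hc], Fintype.card F + 1, by simp, fun ι _ c => ?_⟩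
    have h1 := ncard_range_le_of_not_shatters hv (fun i : F × ι => (i.1, c i.2))
    have h2 : (Set.range (pattern (t := []) φ (Size.nil (v * p + 1)) c)).ncard ≤
        (Set.range fun (y : T → Tower M a []) (i : F × ι) => φ i.1 (c i.2) y).ncard := by
      have : Set.range (pattern (t := []) φ (Size.nil (v * p + 1)) c) =
        (fun P : F × ι → Prop => fun _ g i => P (g, i)) ''
        (Set.range fun (y : T → Tower M a []) (i : F × ι) => φ i.1 (c i.2) y) := by
        rw [← Set.range_comp]; rfl
      rw [this]
      exact Set.ncard_image_le (Set.toFinite _)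
    rw [hc]
    calc _ ≤ ((Fintype.card (F × ι) + 1) ^ v) ^ p := by gcongr; exact h2.trans h1
      _ ≤ (((Fintype.card F + 1) * (Fintype.card ι + 1)) ^ v) ^ p := by
        gcongr; rw [Fintype.card_prod]; nlinarith
      _ = ((Fintype.card F + 1) * (Fintype.card ι + 1)) ^ (v * p) := by rw [pow_mul]
      _ ≤ _ := by
        refine Nat.pow_le_pow_right (Nat.mul_pos ?_ ?_) (by omega) <;> omega
  | m :: t, T, F, _, _, K, φ, h => by
    obtain ⟨v, hv, hr⟩ := h
    -- Per lower cell, `v + 1` pays for passing to `(v + 1)`-tuples of parameters, and `v * p` for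
    -- the `p`-th power of the Sauer–Shelah factor.
    obtain ⟨r, hrd⟩ : ∃ r, r = v + 1 + v * p := ⟨_, rfl⟩
    obtain ⟨s, hs, B, hB, hle⟩ :=
      exists_ncard_range_pattern_pow_le p t (T × Fin r) (Fin (v + 1) → F × Fin r × Bool)
        (Fin (v + 1) → K) _ (hr r)
    have hc := Cell.card_cons m s r
    obtain ⟨q, hq⟩ : ∃ q, q = Fintype.card (Cell t s) := ⟨_, rfl⟩
    have hr0 : 1 ≤ r := by omega
    have hB' : 1 ≤ B * (Fintype.card F * r + 1) ^ (v * p) :=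
      Nat.mul_pos hB (Nat.pow_pos (by omega))
    refine ⟨Size.cons m s r, by rw [hc]; exact Nat.mul_pos hs hr0,
      B * (Fintype.card F * r + 1) ^ (v * p), hB', fun ι _ c => ?_⟩
    have h1 := ncard_range_pattern_cons_le hv s r c
    have h2 := hle (Fin (v + 1) → ι) (fun q => c ∘ q)
    rw [hc, ← hq]
    rw [← hq] at h1 h2
    obtain ⟨n, hn⟩ : ∃ n, n = Fintype.card ι := ⟨_, rfl⟩
    have h3 : Fintype.card (Fin (v + 1) → ι) + 1 ≤ (n + 1) ^ (v + 1) := by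
      rw [Fintype.card_fun, Fintype.card_fin, ← hn]
      exact Nat.pow_lt_pow_left (Nat.lt_succ_self n) (by omega)
    rw [← hn] at h1 ⊢
    calc _ ≤ (_ * ((Fintype.card F * n * r + 1) ^ v) ^ q) ^ p := Nat.pow_le_pow_left h1 p
      _ = _ ^ p * (((Fintype.card F * n * r + 1) ^ v) ^ q) ^ p := mul_pow _ _ _
      _ ≤ (B * (n + 1) ^ (v + 1)) ^ q *
          ((((Fintype.card F * r + 1) * (n + 1)) ^ v) ^ q) ^ p := by
        refine Nat.mul_le_mul (h2.trans (by gcongr)) ?_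
        gcongr
        nlinarith [Nat.zero_le (Fintype.card F * r)]
      _ = ((B * (Fintype.card F * r + 1) ^ (v * p)) * (n + 1) ^ r) ^ q := by
        rw [hrd, pow_add (n + 1) (v + 1)]
        simp only [mul_pow, ← pow_mul]
        rw [show v * q * p = v * p * q by ring]
        ring
      _ ≤ ((B * (Fintype.card F * r + 1) ^ (v * p)) ^ r * (n + 1) ^ r) ^ q := by
        gcongr
        exact Nat.le_self_pow (by omega) _
      _ = _ := by rw [← mul_pow, ← pow_mul, mul_comm r]

/-! ### Building configurations from density -/

/-- A filter on the tuples of each level of a tower. -/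
def FilterTower (M : Type w) : List ℕ → Type w
  | [] => PUnit
  | m :: t => FilterTower M t × Filter (Fin m → M)

/-- The iterated quantifier "for positively many" over the levels of a tower. -/
def TowerFrequently {M : Type w} {a : ℕ} :
    (t : List ℕ) → FilterTower M t → (Tower M a t → Prop) → (Fin a → M) → Prop
  | [], _, ψ => ψ
  | _ :: t, F, ψ => TowerFrequently t F.1 fun y => ∃ᶠ z in F.2, ψ (y, z)

/-- Every filter of `F'` is the restriction of the corresponding filter of `F` to a positive set. -/
def FilterTower.Refines {M : Type w} :
    (t : List ℕ) → FilterTower M t → FilterTower M t → Prop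
  | [], _, _ => True
  | _ :: t, F', F => FilterTower.Refines t F'.1 F.1 ∧
      ∃ J, (∃ᶠ z in F.2, z ∈ J) ∧ F'.2 = F.2 ⊓ Filter.principal J

theorem TowerFrequently.mono {M : Type w} {a : ℕ} :
    ∀ {t : List ℕ} {F : FilterTower M t} {ψ ψ' : Tower M a t → Prop} {α : Fin a → M},
      TowerFrequently t F ψ α → (∀ y, ψ y → ψ' y) → TowerFrequently t F ψ' α
  | [], _, _, _, _, h, hψ => hψ _ h
  | _ :: t, F, _, _, _, h, hψ =>
    TowerFrequently.mono (t := t) (F := F.1) h fun _ hy => hy.mono fun _ hz => hψ _ hz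

theorem Config.nonempty (M : Type w) [Nonempty M] (a : ℕ) :
    ∀ (t : List ℕ) (s : Size t), Nonempty (Config M a t s)
  | [], _ => ⟨fun _ => Classical.arbitrary M⟩
  | _ :: t, s => ⟨fun _ => (Config.nonempty M a t s.1).some, fun _ _ => Classical.arbitrary M⟩

theorem frequently_inf_principal_iff {A : Type*} {D : Filter A} {S : Set A} {p : A → Prop} :
    (∃ᶠ z in D ⊓ Filter.principal S, p z) ↔ ∃ᶠ z in D, z ∈ S ∧ p z := by
  simp only [Filter.Frequently, Filter.eventually_inf_principal]
  exact not_congr (Filter.eventually_congr (Filter.Eventually.of_forall fun z => by tauto))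

/-- Finitely many parameters can be chosen one after another so that for each of finitely many
states positively many points satisfy all requirements. -/
theorem exists_forall_frequently_forall {A K X Γ : Type*} [Finite X] [Finite Γ]
    {DA : Filter A} [DA.NeBot] {DK : Filter K} [DK.NeBot] (R : Γ → X → K → A → Prop)
    (h : ∀ σ x, ∀ S : Set A, (∃ᶠ α in DA, α ∈ S) → ∀ᶠ p in DK, ∃ᶠ α in DA, α ∈ S ∧ R σ x p α) :
    ∃ c : X → K, ∀ σ, ∃ᶠ α in DA, ∀ x, R σ x (c x) α := by
  classical
  have : Fintype X := Fintype.ofFinite X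
  have key : ∀ s : Finset X, ∃ c : X → K, ∀ σ, ∃ᶠ α in DA, ∀ x ∈ s, R σ x (c x) α := by
    intro s
    induction s using Finset.induction_on with
    | empty =>
      have : Nonempty K := DK.nonempty_of_neBot
      exact ⟨fun _ => Classical.arbitrary K, fun σ =>
        (Filter.Eventually.of_forall fun α => by simp).frequently⟩
    | insert x s hx ih =>
      obtain ⟨c, hc⟩ := ih
      -- Each of the finitely many states accepts almost all `p`, so one `p` serves them all.
      obtain ⟨p, hp⟩ := (Filter.eventually_all.2 fun σ => h σ x _ (hc σ)).exists
      refine ⟨Function.update c x p, fun σ => (hp σ).mono fun α hα y hy => ?_⟩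
      rcases Finset.mem_insert.1 hy with rfl | hys
      · simpa using hα.2
      · have : y ≠ x := fun h => hx (h ▸ hys)
        rw [Function.update_of_ne this]
        exact hα.1 y hys
  obtain ⟨c, hc⟩ := key Finset.univ
  exact ⟨c, fun σ => (hc σ).mono fun α hα x => hα x (Finset.mem_univ x)⟩

/-- At each cell, density of `φ` handles the chosen parameter and density of `N` refutes the others.
Parameters must be fixed before `η` is known, whereas the positive sets found along the way depend
on `η`; the finite set `Ω` carries this dependence through the recursion. Those positive sets enter
as refinements `F'`. -/
theorem exists_config_of_frequently {M : Type w} [Nonempty M] {a : ℕ} {K : Type w}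
    {DA : Filter (Fin a → M)} [DA.NeBot] {DK : Filter K} [DK.NeBot]
    (N : K → (Fin a → M) → Prop)
    (hN : ∀ S : Set (Fin a → M), (∃ᶠ α in DA, α ∈ S) →
      ∀ᶠ p in DK, ∃ᶠ α in DA, α ∈ S ∧ N p α) :
    ∀ (t : List ℕ) (F : FilterTower M t) (_ : F.Refines t F) (s : Size t) (L : ℕ)
      (Ω : Type) [Finite Ω] (φ : Ω → Cell t s → K → Tower M a t → Prop)
      (_ : ∀ ω e, ∀ F', FilterTower.Refines t F' F → ∀ S : Set (Fin a → M),
        (∃ᶠ α in DA, α ∈ S) →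
        ∀ᶠ p in DK, ∃ᶠ α in DA, α ∈ S ∧ TowerFrequently t F' (φ ω e p) α)
      (_ : ∀ ω e p α, N p α → ¬ TowerFrequently t F (φ ω e p) α),
      ∃ c : Cell t s → Fin L → K, ∀ ω (η : Cell t s → Fin L), ∃ f : Config M a t s,
        ∀ e l, φ ω e (c e l) (Config.eval t s f e) ↔ l = η e
  | [], F, _, s, L, Ω, _, φ, hW, hNφ => by
    classical
    obtain ⟨c, hc⟩ := exists_forall_frequently_forall (DA := DA) (DK := DK)
      (X := Cell [] s × Fin L) (Γ := Ω × (Cell [] s → Fin L))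
      (fun σ x p α => (x.2 = σ.2 x.1 → TowerFrequently [] F (φ σ.1 x.1 p) α) ∧
        (x.2 ≠ σ.2 x.1 → N p α)) (by
        intro σ x S hS
        by_cases h : x.2 = σ.2 x.1
        · exact (hW σ.1 x.1 F trivial S hS).mono fun p hp => hp.mono fun α hα =>
            ⟨hα.1, fun _ => hα.2, fun h' => absurd h h'⟩
        · exact (hN S hS).mono fun p hp => hp.mono fun α hα =>
            ⟨hα.1, fun h' => absurd h' h, fun _ => hα.2⟩)
    refine ⟨fun e l => c (e, l), fun ω η => ?_⟩
    obtain ⟨α, hα⟩ := (hc (ω, η)).exists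
    refine ⟨α, fun e l => ⟨fun h => ?_, (hα (e, l)).1⟩⟩
    by_contra hl
    exact hNφ ω e _ α ((hα (e, l)).2 hl) h
  | m :: t, F, hF, s, L, Ω, _, φ, hW, hNφ => by
    classical
    have hK : Nonempty K := DK.nonempty_of_neBot
    have hC := Config.nonempty M a t s.1
    have key : ∀ k : ℕ, k ≤ s.2 → ∃ c : Cell t s.1 → Fin s.2 → Fin L → K,
        ∀ ω (η : Cell t s.1 → Fin s.2 → Fin L),
        ∃ (f : Fin s.2 → Config M a t s.1) (J : Cell t s.1 → Set (Fin m → M)),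
          (∀ e, ∃ᶠ z in F.2, z ∈ J e) ∧ ∀ e, ∀ z ∈ J e, ∀ i : Fin s.2, (i : ℕ) < k → ∀ l,
            (φ ω (e, i) (c e i l) (Config.eval t s.1 (f i) e, z) ↔ l = η e i) := by
      intro k
      induction k with
      | zero =>
        obtain ⟨J, hJ, -⟩ := hF.2
        exact fun _ => ⟨fun _ _ _ => Classical.arbitrary K, fun ω η =>
          ⟨fun _ => Classical.arbitrary _, fun _ => J, fun _ => hJ,
            fun e z _ i hi => absurd hi (Nat.not_lt_zero _)⟩⟩
      | succ k ih =>
        intro hk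
        obtain ⟨c₀, hc₀⟩ := ih (Nat.le_of_succ_le hk)
        choose f₀ J₀ hJ₀ hφ₀ using hc₀
        let i₀ : Fin s.2 := ⟨k, hk⟩
        -- The coordinate `i₀` is added one level down, with `(ω, η)` as the state and with truth of
        -- `φ` replaced by frequent truth inside `J₀`.
        obtain ⟨c₁, hc₁⟩ := exists_config_of_frequently N hN t F.1 hF.1 s.1 L
          (Ω × (Cell t s.1 → Fin s.2 → Fin L))
          (fun ω e p y => ∃ᶠ z in F.2, z ∈ J₀ ω.1 ω.2 e ∧ φ ω.1 (e, i₀) p (y, z))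
          (fun ω e F' hF' S hS => by
            have := hW ω.1 (e, i₀) (F', F.2 ⊓ Filter.principal (J₀ ω.1 ω.2 e))
              ⟨hF', _, hJ₀ ω.1 ω.2 e, rfl⟩ S hS
            simpa only [TowerFrequently, frequently_inf_principal_iff] using this)
          (fun ω e p α hα hex => hNφ ω.1 (e, i₀) p α hα
            (TowerFrequently.mono (t := t) (F := F.1) hex fun y hy => hy.mono fun z hz => hz.2))
        refine ⟨fun e i => if i = i₀ then c₁ e else c₀ e i, fun ω η => ?_⟩
        obtain ⟨f₁, hf₁⟩ := hc₁ (ω, η) (fun e => η e i₀)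
        refine ⟨Function.update (f₀ ω η) i₀ f₁, fun e => {z | z ∈ J₀ ω η e ∧
          ∀ l, φ ω (e, i₀) (c₁ e l) (Config.eval t s.1 f₁ e, z) ↔ l = η e i₀},
          fun e => ?_, fun e z hz i hi l => ?_⟩
        · have h1 := (hf₁ e (η e i₀)).2 rfl
          -- A wrong parameter is not frequently true inside `J₀`, so almost every point of `J₀`
          -- refutes it; there are finitely many `l`.
          have h2 : ∀ᶠ z in F.2, ∀ l, l ≠ η e i₀ →
              ¬ (z ∈ J₀ ω η e ∧ φ ω (e, i₀) (c₁ e l) (Config.eval t s.1 f₁ e, z)) := by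
            refine Filter.eventually_all.2 fun l => ?_
            by_cases hl : l = η e i₀
            · simp [hl]
            · have := mt (hf₁ e l).1 hl
              rw [Filter.not_frequently] at this
              exact this.mono fun z hz _ => hz
          refine (h1.and_eventually h2).mono fun z hz => ⟨hz.1.1, fun l => ⟨fun h => ?_, ?_⟩⟩
          · by_contra hl
            exact hz.2 l hl ⟨hz.1.1, h⟩
          · rintro rfl
            exact hz.1.2
        · by_cases h : i = i₀
          · subst h
            simpa using hz.2 l
          · have : (i : ℕ) < k :=
              lt_of_le_of_ne (Nat.lt_succ_iff.1 hi) fun h' => h (Fin.ext h')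
            simpa [h] using hφ₀ ω η e z hz.1 i this l
    obtain ⟨c, hc⟩ := key s.2 le_rfl
    refine ⟨fun e => c e.1 e.2, fun ω η => ?_⟩
    obtain ⟨f, J, hJ, hf⟩ := hc ω fun e i => η (e, i)
    choose z hz using fun e => (hJ e).exists
    exact ⟨(f, z), fun e l => hf e.1 (z e.1) (hz e.1) e.2 e.2.2 l⟩

theorem false_of_tame_of_frequently {M : Type w} [Nonempty M] {a : ℕ} {K : Type w}
    {DA : Filter (Fin a → M)} [DA.NeBot] {DK : Filter K} [DK.NeBot]
    {N : K → (Fin a → M) → Prop} {t : List ℕ} {F : FilterTower M t} {φ : K → Tower M a t → Prop}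
    (hφ : Tame M a t Unit Unit K fun _ p y => φ p (y ()))
    (hF : F.Refines t F)
    (hW : ∀ F', FilterTower.Refines t F' F → ∀ S : Set (Fin a → M), (∃ᶠ α in DA, α ∈ S) →
        ∀ᶠ p in DK, ∃ᶠ α in DA, α ∈ S ∧ TowerFrequently t F' (φ p) α)
    (hN : ∀ S : Set (Fin a → M), (∃ᶠ α in DA, α ∈ S) →
      ∀ᶠ p in DK, ∃ᶠ α in DA, α ∈ S ∧ N p α)
    (hNφ : ∀ p α, N p α → ¬ TowerFrequently t F (φ p) α) : False := by
  classical
  obtain ⟨s, hs, B, hB, hU⟩ := exists_ncard_range_pattern_pow_le 2 t Unit Unit K _ hφ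
  obtain ⟨E, hE⟩ : ∃ E, E = Fintype.card (Cell t s) := ⟨_, rfl⟩
  -- The `L ^ E` choices `η` give distinct patterns over `E * L` parameters, whence `L ^ 2 ≤ B * (E
  -- * L + 1) ≤ B * (E + 1) * L`; this `L` is just too large.
  obtain ⟨L, hL⟩ : ∃ L, L = B * (E + 1) + 1 := ⟨_, rfl⟩
  obtain ⟨c, hc⟩ := exists_config_of_frequently N hN t F hF s L Unit (fun _ _ => φ)
    (fun _ _ => hW) (fun _ _ => hNφ)
  choose f hf using hc ()
  have h1 := hU (Cell t s × Fin L) fun i => c i.1 i.2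
  have h2 : Fintype.card (Cell t s → Fin L) ≤ (Set.range (pattern (T := Unit) (F := Unit)
      (fun _ p y => φ p (y ())) s fun i : Cell t s × Fin L => c i.1 i.2)).ncard := by
    rw [← Nat.card_eq_fintype_card, ← Set.ncard_univ]
    refine Set.ncard_le_ncard_of_injOn
      (fun η => pattern (T := Unit) (F := Unit) (fun _ p y => φ p (y ())) s
        (fun i : Cell t s × Fin L => c i.1 i.2) fun _ => f η)
      (fun η _ => ⟨_, rfl⟩) (fun η _ η' _ h => ?_) (Set.toFinite _)
    funext e
    have h3 := congrFun (congrFun (congrFun h e) ()) (e, η e)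
    have h4 := (hf η e (η e)).2 rfl
    exact (hf η' e (η e)).1 (h3.mp h4)
  rw [Fintype.card_fun, Fintype.card_fin, ← hE] at h2
  rw [Fintype.card_prod, Fintype.card_fin, ← hE] at h1
  have h3 : (L ^ 2) ^ E ≤ (B * (E * L + 1)) ^ E := by
    rw [← pow_mul, mul_comm, pow_mul]
    exact (Nat.pow_le_pow_left h2 2).trans h1
  have h4 : L ^ 2 ≤ B * (E * L + 1) := (Nat.pow_le_pow_iff_left (by omega)).1 h3
  have h5 : B * (E * L + 1) ≤ B * (E + 1) * L := by
    rw [mul_assoc]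
    exact Nat.mul_le_mul_left _ (by nlinarith)
  nlinarith

/-! ### Bounded shattering in models of a dependent theory -/

theorem Shatters.mono {X Y : Type*} {R : X → Y → Prop} {r r' : ℕ} (h : Shatters R r)
    (j : Fin r' ↪ Fin r) : Shatters R r' := by
  obtain ⟨b, hb⟩ := h
  refine ⟨b ∘ j, fun A => ?_⟩
  obtain ⟨y, hy⟩ := hb (j '' A)
  exact ⟨y, fun i => (hy (j i)).trans (j.injective.mem_set_image)⟩

theorem Shatters.map {X Y X' Y' : Type*} {R : X → Y → Prop} {R' : X' → Y' → Prop} {r : ℕ}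
    (h : Shatters R r) (f : X → X') (g : Y → Y') (hR : ∀ x y, R x y ↔ R' (f x) (g y)) :
    Shatters R' r := by
  obtain ⟨b, hb⟩ := h
  refine ⟨f ∘ b, fun A => ?_⟩
  obtain ⟨y, hy⟩ := hb A
  exact ⟨g y, fun i => (hR _ _).symm.trans (hy i)⟩

/-- A finite disjoint union of relations that do not shatter large families does not shatter large
families. -/
theorem exists_not_shatters_prod {F X Y : Type*} [Finite F] {R : F → X → Y → Prop}
    (h : ∀ g, ∃ v, ¬ Shatters (R g) (v + 1)) :
    ∃ v, ¬ Shatters (fun (p : F × X) y => R p.1 p.2 y) (v + 1) := by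
  classical
  have : Fintype F := Fintype.ofFinite F
  choose v hv using h
  -- With one more point than this, pigeonhole puts more than `sup v` points over the same `g`.
  refine ⟨Fintype.card F * Finset.univ.sup v, ?_⟩
  rintro ⟨b, hb⟩
  obtain ⟨g, hg⟩ := Fintype.exists_lt_card_fiber_of_mul_lt_card (fun i => (b i).1)
    (n := Finset.univ.sup v) (by simp)
  set s := Finset.univ.filter fun i => (b i).1 = g
  have hle : v g + 1 ≤ s.card :=
    Nat.succ_le_of_lt (lt_of_le_of_lt (Finset.le_sup (Finset.mem_univ g)) hg)
  let j : Fin (v g + 1) → Fin (Fintype.card F * Finset.univ.sup v + 1) := fun i =>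
    s.equivFin.symm (Fin.castLE hle i)
  have hj : Function.Injective j := Subtype.val_injective.comp
    (s.equivFin.symm.injective.comp (Fin.castLE_injective hle))
  have hjg : ∀ i, (b (j i)).1 = g := fun i =>
    (Finset.mem_filter.1 (s.equivFin.symm (Fin.castLE hle i)).2).2
  refine hv g ⟨fun i => (b (j i)).2, fun A => ?_⟩
  obtain ⟨y, hy⟩ := hb (j '' A)
  refine ⟨y, fun i => ?_⟩
  rw [← hj.mem_set_image (s := A), ← hy (j i)]
  simp only [hjg i]

/-- The formula `ψ` or its negation. -/
noncomputable def literal {L : FirstOrder.Language.{u, v}} {κ : Type*} (ψ : L.Formula κ) (b : Bool) :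
    L.Formula κ :=
  if b then ψ else ψ.not

@[simp]
theorem realize_literal {L : FirstOrder.Language.{u, v}} {M : Type w} [L.Structure M] {κ : Type*}
    (ψ : L.Formula κ) (b : Bool) (x : κ → M) :
    (literal ψ b).Realize x ↔ (ψ.Realize x ↔ b = true) := by
  cases b <;> simp [literal]

/-- Every formula shatters only families of bounded size in `M`. -/
def BoundedShattering (L : FirstOrder.Language.{u, v}) (M : Type w) [L.Structure M] : Prop :=
  ∀ (κ₁ κ₂ : Type) [Finite κ₁] [Finite κ₂] (ψ : L.Formula (κ₁ ⊕ κ₂)),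
    ∃ r, ¬ Shatters (fun (b : κ₂ → M) (a : κ₁ → M) => ψ.Realize (Sum.elim a b)) (r + 1)

/-- The sentence that the formula `ψ` shatters a family of size `r`. -/
noncomputable def shatterSentence {L : FirstOrder.Language.{u, v}} {m k : ℕ}
    (ψ : L.Formula (Fin m ⊕ Fin k)) (r : ℕ) : L.Sentence := by
  classical
  exact Formula.iExs (Fin r × Fin k) (Formula.iInf fun A : Set (Fin r) =>
    Formula.iExs (Fin m) (Formula.iInf fun i : Fin r =>
      (literal ψ (decide (i ∈ A))).relabel
        (Sum.elim (fun p => Sum.inr p) fun q => Sum.inl (Sum.inr (i, q)))))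

theorem realize_shatterSentence {L : FirstOrder.Language.{u, v}} {M : Type w} [L.Structure M] {m k : ℕ}
    (ψ : L.Formula (Fin m ⊕ Fin k)) (r : ℕ) :
    M ⊨ shatterSentence ψ r ↔
      Shatters (fun (b : Fin k → M) (a : Fin m → M) => ψ.Realize (Sum.elim a b)) r := by
  have key : ∀ (d : Empty → M) (b : Fin r × Fin k → M) (a : Fin m → M) (i : Fin r),
      Sum.elim (Sum.elim d b) a ∘
        (Sum.elim (fun p => Sum.inr p) fun q => Sum.inl (Sum.inr (i, q))) =
      Sum.elim a fun q => b (i, q) := by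
    intro d b a i
    ext (p | q) <;> rfl
  simp only [shatterSentence, Sentence.Realize, Formula.realize_iExs, Formula.realize_iInf,
    Formula.realize_relabel, key, realize_literal, decide_eq_true_eq, Shatters]
  exact ⟨fun ⟨b, hb⟩ => ⟨fun i q => b (i, q), hb⟩, fun ⟨b, hb⟩ => ⟨fun p => b p.1 p.2, hb⟩⟩

/-- Shattering a family of given size is a first-order sentence, so completeness moves it from `M`
to a model in the universe where dependence is assumed. -/
theorem boundedShattering_of_isDependent {L : FirstOrder.Language.{u, v}} {T : L.Theory}
    (hT : T.IsComplete) (hdep : IsDependent T) (M : Type w) [L.Structure M] [T.Model M]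
    [Nonempty M] : BoundedShattering L M := by
  intro κ₁ κ₂ _ _ ψ
  by_contra! h
  obtain ⟨m, ⟨e₁⟩⟩ := Finite.exists_equiv_fin κ₁
  obtain ⟨k, ⟨e₂⟩⟩ := Finite.exists_equiv_fin κ₂
  obtain ⟨N⟩ := hT.1
  refine hdep N m k (ψ.relabel (Sum.map e₁ e₂)) fun r => ?_
  suffices hs : N ⊨ shatterSentence (ψ.relabel (Sum.map e₁ e₂)) r from
    (realize_shatterSentence _ _).1 hs
  rw [hT.realize_sentence_iff, ← hT.realize_sentence_iff _ M, realize_shatterSentence]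
  refine ((h r).mono (Fin.castSuccEmb)).map (fun b => b ∘ e₂.symm) (fun a => a ∘ e₁.symm)
    fun b a => ?_
  rw [Formula.realize_relabel]
  have : Sum.elim (a ∘ e₁.symm) (b ∘ e₂.symm) ∘ Sum.map e₁ e₂ = Sum.elim a b := by
    ext (p | q) <;> simp
  rw [this]

/-! ### Tameness of relations given by formulas -/

/-- The index set of the coordinates of a tower point. -/
def TowerIndex (a : ℕ) : List ℕ → Type
  | [] => Fin a
  | m :: t => TowerIndex a t ⊕ Fin m

instance TowerIndex.finite (a : ℕ) : ∀ t : List ℕ, Finite (TowerIndex a t)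
  | [] => inferInstanceAs (Finite (Fin a))
  | m :: t =>
    have := TowerIndex.finite a t
    show Finite (TowerIndex a t ⊕ Fin m) from inferInstance

/-- The coordinates of a tower point. -/
def Tower.coord {M : Type w} {a : ℕ} : {t : List ℕ} → Tower M a t → TowerIndex a t → M
  | [], y => y
  | _ :: _, y => Sum.elim (Tower.coord y.1) y.2

/-- A relation on tuples of tower points that is given by formulas in coordinates. -/
def IsFormulaic (L : FirstOrder.Language.{u, v}) {M : Type w} [L.Structure M] {a : ℕ} {t : List ℕ}
    {T F κ : Type} {K : Type w} (coordK : K → κ → M) (φ : F → K → (T → Tower M a t) → Prop) :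
    Prop :=
  ∀ g, ∃ ψ : L.Formula (κ ⊕ T × TowerIndex a t), ∀ k y,
    φ g k y ↔ ψ.Realize (Sum.elim (coordK k) fun p => (y p.1).coord p.2)

/-- This keeps the recursion of `Tame` within formulas: as `T` is finite, the witness `z` amounts to
finitely many quantified elements. -/
theorem IsFormulaic.consistency {L : FirstOrder.Language.{u, v}} {M : Type w} [L.Structure M] {a m : ℕ}
    {t : List ℕ} {T F κ : Type} [Finite T] {K : Type w} {coordK : K → κ → M}
    {φ : F → K → (T → Tower M a (m :: t)) → Prop} (h : IsFormulaic L coordK φ) (n r : ℕ) :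
    IsFormulaic L (κ := Fin n × κ) (fun (k : Fin n → K) p => coordK (k p.1) p.2)
      (consistency φ n r) := by
  choose ψ hψ using h
  intro g
  let ρ : Fin n → κ ⊕ T × TowerIndex a (m :: t) →
      ((Fin n × κ) ⊕ (T × Fin r) × TowerIndex a t) ⊕ T × Fin m := fun l =>
    Sum.elim (fun c => Sum.inl (Sum.inl (l, c))) fun p =>
      Sum.elim (fun j => Sum.inl (Sum.inr ((p.1, (g l).2.1), j))) (fun j => Sum.inr (p.1, j)) p.2
  refine ⟨Formula.iExs (T × Fin m) (Formula.iInf fun l : Fin n =>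
    (literal (ψ (g l).1) (g l).2.2).relabel (ρ l)), fun k y => ?_⟩
  have key : ∀ (z : T → Fin m → M) l,
      Sum.elim (Sum.elim (fun p : Fin n × κ => coordK (k p.1) p.2)
        fun p : (T × Fin r) × TowerIndex a t => (y p.1).coord p.2)
        (fun p : T × Fin m => z p.1 p.2) ∘ ρ l =
      Sum.elim (coordK (k l)) fun p : T × TowerIndex a (m :: t) =>
        Tower.coord (t := m :: t) (y (p.1, (g l).2.1), z p.1) p.2 := by
    intro z l
    funext q
    rcases q with c | ⟨i, j | j⟩ <;> rfl
  have key' : ∀ (z : T → Fin m → M) l, _ ↔ _ := fun z l =>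
    iff_congr ((hψ (g l).1 (k l) fun i => (y (i, (g l).2.1), z i)).trans
      (iff_of_eq (congrArg _ (key z l).symm))) (Iff.refl ((g l).2.2 = true))
  simp only [Formula.realize_iExs, Formula.realize_iInf, Formula.realize_relabel, realize_literal]
  exact ⟨fun ⟨z, hz⟩ => ⟨fun p => z p.1 p.2, fun l => (key' z l).1 (hz l)⟩,
    fun ⟨z, hz⟩ => ⟨fun i j => z (i, j), fun l => (key' _ l).2 (hz l)⟩⟩

theorem IsFormulaic.tame {L : FirstOrder.Language.{u, v}} {M : Type w} [L.Structure M]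
    (hM : BoundedShattering L M) {a : ℕ} :
    ∀ {t : List ℕ} {T F κ : Type} [Finite T] [Finite F] [Finite κ] {K : Type w}
      {coordK : K → κ → M} {φ : F → K → (T → Tower M a t) → Prop}, IsFormulaic L coordK φ →
      Tame M a t T F K φ
  | [], T, F, κ, _, _, _, K, coordK, φ, h => by
    choose ψ hψ using h
    refine exists_not_shatters_prod (R := φ) fun g => ?_
    obtain ⟨r, hr⟩ := hM (T × TowerIndex a []) κ ((ψ g).relabel Sum.swap)
    refine ⟨r, fun hs => hr (hs.map coordK (fun y p => (y p.1).coord p.2) fun k y => ?_)⟩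
    rw [Formula.realize_relabel, hψ, Sum.elim_swap]
  | m :: t, T, F, κ, _, _, _, K, coordK, φ, h => by
    have h' := h
    choose ψ hψ using h'
    obtain ⟨v, hv⟩ := exists_not_shatters_prod
      (R := fun g (p : K × (T → Tower M a t)) (z : T → Fin m → M) =>
        φ g p.1 fun i => (p.2 i, z i)) fun g => by
      let ρ : κ ⊕ T × TowerIndex a (m :: t) → (T × Fin m) ⊕ (κ ⊕ T × TowerIndex a t) :=
        Sum.elim (fun c => Sum.inr (Sum.inl c)) fun p =>
          Sum.elim (fun j => Sum.inr (Sum.inr (p.1, j))) (fun j => Sum.inl (p.1, j)) p.2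
      obtain ⟨r, hr⟩ := hM _ _ ((ψ g).relabel ρ)
      refine ⟨r, fun hs => hr (hs.map
        (fun p => Sum.elim (coordK p.1) fun q => (p.2 q.1).coord q.2)
        (fun z p => z p.1 p.2) fun p z => ?_)⟩
      rw [Formula.realize_relabel]
      refine (hψ _ _ _).trans (iff_of_eq (congrArg _ ?_))
      funext q
      rcases q with c | ⟨i, j | j⟩ <;> rfl
    exact ⟨v, hv, fun r => IsFormulaic.tame hM (h.consistency (v + 1) r)⟩

/-! ### Density on positive rectangles -/

/-- The iterated quantifier "for positively many" over a finite sequence of filters. -/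
def RectFrequently {M : Type w} : {n : ℕ} → {m : Fin n → ℕ} → (∀ ℓ, Filter (Fin (m ℓ) → M)) →
    ((∀ ℓ, Fin (m ℓ) → M) → Prop) → Prop
  | 0, _, _, ψ => ψ fun ℓ => ℓ.elim0
  | _ + 1, _, D, ψ => ∃ᶠ z in D 0, RectFrequently (fun ℓ => D ℓ.succ) fun s => ψ (Fin.cons z s)

/-- The list of levels `t` followed by the levels `m 0, …, m (n - 1)`. -/
def appendLevels : List ℕ → {n : ℕ} → (Fin n → ℕ) → List ℕ
  | t, 0, _ => t
  | t, _ + 1, m => appendLevels (m 0 :: t) fun ℓ => m ℓ.succ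

/-- A tower of filters followed by a finite sequence of filters. -/
def FilterTower.append {M : Type w} : {t : List ℕ} → FilterTower M t → {n : ℕ} → {m : Fin n → ℕ} →
    (∀ ℓ, Filter (Fin (m ℓ) → M)) → FilterTower M (appendLevels t m)
  | _, F, 0, _, _ => F
  | t, F, _ + 1, m, D => FilterTower.append (t := m 0 :: t) (F, D 0) fun ℓ => D ℓ.succ

/-- Split a point of an extended tower. -/
def Tower.split {M : Type w} {a : ℕ} : {t : List ℕ} → {n : ℕ} → {m : Fin n → ℕ} →
    Tower M a (appendLevels t m) → Tower M a t × (∀ ℓ, Fin (m ℓ) → M)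
  | _, 0, _, y => (y, fun ℓ => ℓ.elim0)
  | t, _ + 1, m, y =>
    let p := Tower.split (t := m 0 :: t) (m := fun ℓ => m ℓ.succ) y
    (p.1.1, Fin.cons p.1.2 p.2)

theorem towerFrequently_append {M : Type w} {a : ℕ} {n : ℕ} : ∀ {t : List ℕ}
    {F : FilterTower M t} {m : Fin n → ℕ} {D : ∀ ℓ, Filter (Fin (m ℓ) → M)}
    {ψ : Tower M a t → (∀ ℓ, Fin (m ℓ) → M) → Prop} {α : Fin a → M},
    TowerFrequently (appendLevels t m) (F.append D)
      (fun y => ψ (Tower.split y).1 (Tower.split y).2) α ↔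
    TowerFrequently t F (fun y => RectFrequently D (ψ y)) α := by
  induction n with
  | zero => exact Iff.rfl
  | succ n ih =>
    intro t F m D ψ α
    exact ih (t := m 0 :: t) (F := (F, D 0)) (D := fun ℓ => D ℓ.succ)
      (ψ := fun y s => ψ y.1 (Fin.cons y.2 s))

theorem FilterTower.Refines.append {M : Type w} {n : ℕ} : ∀ {t : List ℕ}
    {F : FilterTower M t} {m : Fin n → ℕ} {D : ∀ ℓ, Filter (Fin (m ℓ) → M)},
    F.Refines t F → (∀ ℓ, (D ℓ).NeBot) → FilterTower.Refines _ (F.append D) (F.append D) := by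
  induction n with
  | zero => exact fun h _ => h
  | succ n ih =>
    intro t F m D h hD
    refine ih (t := m 0 :: t) (F := (F, D 0)) (D := fun ℓ => D ℓ.succ)
      ⟨h, Set.univ, ?_, by simp⟩ fun ℓ => hD ℓ.succ
    have := hD 0
    exact (Filter.Eventually.of_forall fun z => Set.mem_univ z).frequently

/-- Brings an abstract refinement into the form of a positive rectangle, to which a density
hypothesis applies. -/
theorem FilterTower.Refines.exists_of_append {M : Type w} {n : ℕ} : ∀ {t : List ℕ}
    {F : FilterTower M t} {m : Fin n → ℕ} {D : ∀ ℓ, Filter (Fin (m ℓ) → M)}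
    {F' : FilterTower M (appendLevels t m)}, FilterTower.Refines _ F' (F.append D) →
    ∃ (G : FilterTower M t) (R : ∀ ℓ, Set (Fin (m ℓ) → M)), G.Refines t F ∧
      (∀ ℓ, ∃ᶠ z in D ℓ, z ∈ R ℓ) ∧
      F' = G.append fun ℓ => D ℓ ⊓ Filter.principal (R ℓ) := by
  induction n with
  | zero => exact fun {t F m D F'} h => ⟨F', fun ℓ => ℓ.elim0, h, fun ℓ => ℓ.elim0, rfl⟩
  | succ n ih =>
    intro t F m D F' h
    obtain ⟨⟨G, G₂⟩, R, ⟨hG, J, hJ, hJ'⟩, hR, rfl⟩ :=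
      ih (t := m 0 :: t) (F := (F, D 0)) (D := fun ℓ => D ℓ.succ) h
    refine ⟨G, Fin.cons J R, hG, Fin.cases hJ hR, ?_⟩
    dsimp only at hJ'
    subst hJ'
    rfl

theorem Tower.exists_coord_split {M : Type w} {a n : ℕ} : ∀ {t : List ℕ} {m : Fin n → ℕ},
    ∃ (g₁ : TowerIndex a t → TowerIndex a (appendLevels t m))
      (g₂ : ∀ ℓ, Fin (m ℓ) → TowerIndex a (appendLevels t m)),
      ∀ y : Tower M a (appendLevels t m),
        (∀ i, (Tower.split y).1.coord i = y.coord (g₁ i)) ∧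
        ∀ ℓ j, (Tower.split y).2 ℓ j = y.coord (g₂ ℓ j) := by
  induction n with
  | zero => exact fun {t m} => ⟨id, fun ℓ => ℓ.elim0, fun y => ⟨fun i => rfl, fun ℓ => ℓ.elim0⟩⟩
  | succ n ih =>
    intro t m
    obtain ⟨g₁, g₂, h⟩ := ih (t := m 0 :: t) (m := fun ℓ => m ℓ.succ)
    exact ⟨fun i => g₁ (Sum.inl i), Fin.cases (fun j => g₁ (Sum.inr j)) g₂, fun y =>
      ⟨fun i => (h y).1 (Sum.inl i), Fin.cases (fun j => (h y).1 (Sum.inr j)) (h y).2⟩⟩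

/-- Merge the first tuple of a sequence with parameters. -/
def mergeHead {κ : Type} {n : ℕ} {m : Fin (n + 1) → ℕ} :
    (κ ⊕ Σ ℓ, Fin (m ℓ)) → (κ ⊕ Fin (m 0)) ⊕ Σ ℓ : Fin n, Fin (m ℓ.succ) :=
  Sum.elim (fun c => Sum.inl (Sum.inl c)) fun q =>
    Fin.cases (motive := fun ℓ => Fin (m ℓ) → (κ ⊕ Fin (m 0)) ⊕ Σ ℓ : Fin n, Fin (m ℓ.succ))
      (fun j => Sum.inl (Sum.inr j)) (fun ℓ j => Sum.inr ⟨ℓ, j⟩) q.1 q.2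

theorem elim_comp_mergeHead {M : Type w} {κ : Type} {n : ℕ} {m : Fin (n + 1) → ℕ} (c : κ → M)
    (α : Fin (m 0) → M) (s : ∀ ℓ : Fin n, Fin (m ℓ.succ) → M) :
    Sum.elim (Sum.elim c α) (fun q => s q.1 q.2) ∘ mergeHead =
      Sum.elim c fun q : Σ ℓ, Fin (m ℓ) =>
        Fin.cons (α := fun ℓ => Fin (m ℓ) → M) α s q.1 q.2 := by
  funext q
  rcases q with c | ⟨ℓ, j⟩
  · rfl
  · refine Fin.cases (fun j => rfl) (fun ℓ j => rfl) ℓ j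

/-- In a structure without large shattered families, a relation whose positive and negative
instances are dense in positive rectangles can be decided on a smaller rectangle, up to the
remaining quantifiers. -/
theorem exists_eventually_rectFrequently {L : FirstOrder.Language.{u, v}} {M : Type w}
    [L.Structure M] [Nonempty M] (hM : BoundedShattering L M) {n : ℕ} {m : Fin (n + 1) → ℕ}
    {D : ∀ ℓ, Filter (Fin (m ℓ) → M)} {P : Type w} {DP : Filter P}
    {κ : Type} [Finite κ] {ev : P → κ → M}
    {ψ : L.Formula (κ ⊕ Σ ℓ, Fin (m ℓ))} (b : Bool)
    (h : ∀ S : ∀ ℓ, Set (Fin (m ℓ) → M), (∀ ℓ, ∃ᶠ z in D ℓ, z ∈ S ℓ) →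
      ∀ᶠ p in DP, RectFrequently (fun ℓ => D ℓ ⊓ Filter.principal (S ℓ)) fun s =>
        ψ.Realize (Sum.elim (ev p) fun q => s q.1 q.2) ↔ b = true)
    {Q : ∀ ℓ : Fin n, Set (Fin (m ℓ.succ) → M)} (hQ : ∀ ℓ : Fin n, ∃ᶠ z in D ℓ.succ, z ∈ Q ℓ)
    {S₀ : Set P} (hS₀ : ∃ᶠ p in DP, p ∈ S₀)
    {S₁ : Set (Fin (m 0) → M)} (hS₁ : ∃ᶠ α in D 0, α ∈ S₁) :
    ∃ S₀' ⊆ S₀, ∃ S₁' ⊆ S₁, (∃ᶠ p in DP, p ∈ S₀') ∧ (∃ᶠ α in D 0, α ∈ S₁') ∧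
      ∀ᶠ p in DP, p ∈ S₀' → ∀ᶠ α in D 0, α ∈ S₁' →
        RectFrequently (fun ℓ : Fin n => D ℓ.succ ⊓ Filter.principal (Q ℓ)) fun s =>
          ψ.Realize (Sum.elim (ev p) fun q => Fin.cons (α := fun ℓ => Fin (m ℓ) → M) α s q.1 q.2) ↔
            b = true := by
  -- Then the failure `N` is dense inside `S₀` and `S₁`: were it not frequent on some `S` for
  -- positively many `p` in `S₀`, those `p` together with `S₁ ∩ S` would be the sets sought.
  by_contra! hcon
  set N : P → (Fin (m 0) → M) → Prop := fun p α => ¬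
    RectFrequently (fun ℓ : Fin n => D ℓ.succ ⊓ Filter.principal (Q ℓ)) fun s =>
      ψ.Realize (Sum.elim (ev p) fun q => Fin.cons (α := fun ℓ => Fin (m ℓ) → M) α s q.1 q.2) ↔
        b = true
  have hN : ∀ S : Set (Fin (m 0) → M), (∃ᶠ α in D 0 ⊓ Filter.principal S₁, α ∈ S) →
      ∀ᶠ p in DP ⊓ Filter.principal S₀, ∃ᶠ α in D 0 ⊓ Filter.principal S₁, α ∈ S ∧ N p α := by
    intro S hS
    rw [frequently_inf_principal_iff] at hS
    by_contra hne
    rw [Filter.not_eventually, frequently_inf_principal_iff] at hne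
    obtain ⟨p, hp, hp'⟩ :=
      (hcon _ (fun p hp => hp.1) (S₁ ∩ S) Set.inter_subset_left hne hS).exists
    refine hp.2 ?_
    rw [frequently_inf_principal_iff]
    exact hp'.mono fun α hα => ⟨hα.1.1, hα.1.2, hα.2⟩
  have hDQ : ∀ ℓ : Fin n, (D ℓ.succ ⊓ Filter.principal (Q ℓ)).NeBot := fun ℓ =>
    Filter.frequently_mem_iff_neBot.1 (hQ ℓ)
  have hA : (D 0 ⊓ Filter.principal S₁).NeBot := Filter.frequently_mem_iff_neBot.1 hS₁
  have hP : (DP ⊓ Filter.principal S₀).NeBot := Filter.frequently_mem_iff_neBot.1 hS₀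
  let m' : Fin n → ℕ := fun ℓ => m ℓ.succ
  obtain ⟨g₁, g₂, hg⟩ := Tower.exists_coord_split (M := M) (a := m 0) (t := []) (m := m')
  let φ : P → Tower M (m 0) (appendLevels [] m') → Prop := fun p y =>
    ψ.Realize (Sum.elim (ev p) fun q => Fin.cons (α := fun ℓ => Fin (m ℓ) → M)
      (Tower.split (t := []) (m := m') y).1 (Tower.split (t := []) (m := m') y).2 q.1 q.2) ↔
      b = true
  have hex : ∀ (G : FilterTower M []) (R : ∀ ℓ, Filter (Fin (m' ℓ) → M)) p α,
      TowerFrequently _ (G.append R) (φ p) α ↔ RectFrequently R fun s =>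
        ψ.Realize (Sum.elim (ev p) fun q => Fin.cons (α := fun ℓ => Fin (m ℓ) → M) α s q.1 q.2) ↔
          b = true := fun G R p α =>
    towerFrequently_append (t := []) (ψ := fun y s => ψ.Realize (Sum.elim (ev p)
      fun q => Fin.cons (α := fun ℓ => Fin (m ℓ) → M) y s q.1 q.2) ↔ b = true)
  have htame : Tame M (m 0) (appendLevels [] m') Unit Unit P fun _ p y => φ p (y ()) := by
    refine IsFormulaic.tame hM (coordK := ev) fun _ =>
      ⟨(literal ψ b).relabel (Sum.elim Sum.inl fun q => Sum.inr ((), Fin.cases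
        (motive := fun ℓ => Fin (m ℓ) → TowerIndex (m 0) (appendLevels [] m')) g₁ g₂ q.1 q.2)),
        fun p y => ?_⟩
    rw [Formula.realize_relabel, realize_literal]
    refine iff_congr (iff_of_eq (congrArg _ ?_)) Iff.rfl
    funext q
    rcases q with c | ⟨ℓ, j⟩
    · rfl
    · exact Fin.cases (fun j => (hg (y ())).1 j) (fun ℓ j => (hg (y ())).2 ℓ j) ℓ j
  refine false_of_tame_of_frequently (DA := D 0 ⊓ Filter.principal S₁)
    (DK := DP ⊓ Filter.principal S₀) (N := N)
    (F := FilterTower.append (t := []) PUnit.unit (m := m')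
      fun ℓ => D ℓ.succ ⊓ Filter.principal (Q ℓ)) htame
    (FilterTower.Refines.append (t := []) (F := PUnit.unit) trivial hDQ)
    (fun F' hF' S hS => ?_) hN fun p α hp hf => hp ((hex _ _ _ _).1 hf)
  obtain ⟨G, R, -, hR, rfl⟩ := hF'.exists_of_append (t := [])
  rw [frequently_inf_principal_iff] at hS
  have h1 := h (Fin.cons (S₁ ∩ S) fun ℓ => Q ℓ ∩ R ℓ) (Fin.cases hS fun ℓ => by
    simpa [frequently_inf_principal_iff] using hR ℓ)
  refine (h1.filter_mono inf_le_left).mono fun p hp => ?_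
  simp only [RectFrequently, Fin.cons_zero, Fin.cons_succ, frequently_inf_principal_iff] at hp
  rw [frequently_inf_principal_iff]
  refine hp.mono fun α hα => ⟨hα.1.1, hα.1.2, ?_⟩
  rw [hex]
  simpa only [inf_assoc, Filter.inf_principal] using hα.2

/-- In a structure without large shattered families, a formula and its negation cannot both be
dense in all positive rectangles. -/
theorem not_forall_eventually_rectFrequently {L : FirstOrder.Language.{u, v}} {M : Type w}
    [L.Structure M] [Nonempty M] (hM : BoundedShattering L M) {n : ℕ} :
    ∀ {m : Fin n → ℕ} {D : ∀ ℓ, Filter (Fin (m ℓ) → M)} (_ : ∀ ℓ, (D ℓ).NeBot)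
      {P : Type w} {DP : Filter P} [DP.NeBot] {κ : Type} [Finite κ] (ev : P → κ → M)
      (ψ : L.Formula (κ ⊕ Σ ℓ, Fin (m ℓ))),
      ¬ ∀ (b : Bool) (S : ∀ ℓ, Set (Fin (m ℓ) → M)), (∀ ℓ, ∃ᶠ z in D ℓ, z ∈ S ℓ) →
        ∀ᶠ p in DP, RectFrequently (fun ℓ => D ℓ ⊓ Filter.principal (S ℓ)) fun s =>
          ψ.Realize (Sum.elim (ev p) fun q => s q.1 q.2) ↔ b = true := by
  induction n with
  | zero =>
    -- With no tuples left, both signs would hold at a common parameter.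
    intro m D _ P DP _ κ _ ev ψ h
    obtain ⟨p, hp⟩ := ((h true (fun ℓ => ℓ.elim0) fun ℓ => ℓ.elim0).and
      (h false (fun ℓ => ℓ.elim0) fun ℓ => ℓ.elim0)).exists
    simp only [RectFrequently] at hp
    simp at hp
  | succ n ih =>
    intro m D hD P DP _ κ _ ev ψ h
    let W : Bool → (∀ ℓ : Fin n, Set (Fin (m ℓ.succ) → M)) → Set (P × (Fin (m 0) → M)) :=
      fun b Q => {p | RectFrequently (fun ℓ : Fin n => D ℓ.succ ⊓ Filter.principal (Q ℓ)) fun s =>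
        ψ.Realize (Sum.elim (ev p.1) fun q =>
          Fin.cons (α := fun ℓ => Fin (m ℓ) → M) p.2 s q.1 q.2) ↔ b = true}
    -- Declaring these sets large makes both signs dense for the remaining `n` tuples, with the pair
    -- as parameter.
    let 𝒲 : Set (Set (P × (Fin (m 0) → M))) :=
      {w | ∃ b Q, (∀ ℓ : Fin n, ∃ᶠ z in D ℓ.succ, z ∈ Q ℓ) ∧ w = W b Q}
    have hne : (Filter.generate 𝒲).NeBot := by
      refine Filter.generate_neBot_iff.2 fun t ht hfin => ?_
      -- Nonempty finite intersections would not carry the induction; containing almost all of a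
      -- positive rectangle does, since each further generator only shrinks the two sides.
      have key : ∃ (S₀ : Set P) (S₁ : Set (Fin (m 0) → M)), (∃ᶠ p in DP, p ∈ S₀) ∧
          (∃ᶠ α in D 0, α ∈ S₁) ∧ ∀ᶠ p in DP, p ∈ S₀ → ∀ᶠ α in D 0, α ∈ S₁ → (p, α) ∈ ⋂₀ t := by
        induction t, hfin using Set.Finite.induction_on with
        | empty =>
          have := hD 0
          exact ⟨Set.univ, Set.univ, (Filter.Eventually.of_forall fun _ => trivial).frequently,
            (Filter.Eventually.of_forall fun _ => trivial).frequently, by simp⟩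
        | @insert w t _ _ ih' =>
          obtain ⟨S₀, S₁, hS₀, hS₁, hS⟩ := ih' ((Set.subset_insert _ _).trans ht)
          obtain ⟨b, Q, hQ, rfl⟩ := ht (Set.mem_insert _ _)
          obtain ⟨S₀', h₀, S₁', h₁, hS₀', hS₁', hS'⟩ :=
            exists_eventually_rectFrequently hM b (h b) hQ hS₀ hS₁
          refine ⟨S₀', S₁', hS₀', hS₁', (hS.and hS').mono fun p hp hpS => ?_⟩
          refine ((hp.1 (h₀ hpS)).and (hp.2 hpS)).mono fun α hα hαS => ?_
          rw [Set.sInter_insert]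
          exact ⟨hα.2 hαS, hα.1 (h₁ hαS)⟩
      obtain ⟨S₀, S₁, hS₀, hS₁, hS⟩ := key
      obtain ⟨p, hp, hp'⟩ := (hS₀.and_eventually hS).exists
      obtain ⟨α, hα, hα'⟩ := (hS₁.and_eventually (hp' hp)).exists
      exact ⟨(p, α), hα' hα⟩
    refine ih (D := fun ℓ => D ℓ.succ) (fun ℓ => hD ℓ.succ) (DP := Filter.generate 𝒲)
      (fun p : P × (Fin (m 0) → M) => Sum.elim (ev p.1) p.2) (ψ.relabel mergeHead)
      fun b Q hQ => ?_
    simp only [Formula.realize_relabel, elim_comp_mergeHead]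
    exact Filter.mem_generate_of_mem ⟨b, Q, hQ, rfl⟩

/-! ### The iterated almost-all quantifier and homogeneous rectangles -/

theorem IteratedAlmostAll.mono {n : ℕ} : ∀ {I : Fin n → Type x} {D : ∀ ℓ, Filter (I ℓ)}
    {S S' : ∀ ℓ, Set (I ℓ)} {P P' : (∀ ℓ, I ℓ) → Prop}, IteratedAlmostAll D S P →
    (∀ ℓ, S' ℓ ⊆ S ℓ) → (∀ s, P s → P' s) → IteratedAlmostAll D S' P' := by
  induction n with
  | zero => exact fun {I D S S' P P'} h _ hP => hP _ h
  | succ n ih =>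
    intro I D S S' P P' h hS hP
    exact Filter.Eventually.mono h fun z hz hzS =>
      ih (hz (hS 0 hzS)) (fun ℓ => hS ℓ.succ) fun s => hP _

theorem IteratedAlmostAll.and {n : ℕ} : ∀ {I : Fin n → Type x} {D : ∀ ℓ, Filter (I ℓ)}
    {S : ∀ ℓ, Set (I ℓ)} {P P' : (∀ ℓ, I ℓ) → Prop}, IteratedAlmostAll D S P →
    IteratedAlmostAll D S P' → IteratedAlmostAll D S fun s => P s ∧ P' s := by
  induction n with
  | zero => exact fun {I D S P P'} h h' => ⟨h, h'⟩
  | succ n ih =>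
    intro I D S P P' h h'
    exact (Filter.Eventually.and h h').mono fun z hz hzS => ih (hz.1 hzS) (hz.2 hzS)

theorem IteratedAlmostAll.of_forall {n : ℕ} : ∀ {I : Fin n → Type x} {D : ∀ ℓ, Filter (I ℓ)}
    {S : ∀ ℓ, Set (I ℓ)} {P : (∀ ℓ, I ℓ) → Prop}, (∀ s, P s) → IteratedAlmostAll D S P := by
  induction n with
  | zero => exact fun {I D S P} h => h _
  | succ n ih =>
    intro I D S P h
    exact Filter.Eventually.of_forall fun z _ => ih fun s => h _

theorem IteratedAlmostAll.exists {n : ℕ} : ∀ {I : Fin n → Type x} {D : ∀ ℓ, Filter (I ℓ)}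
    {S : ∀ ℓ, Set (I ℓ)} {P : (∀ ℓ, I ℓ) → Prop}, IteratedAlmostAll D S P →
    (∀ ℓ, ∃ᶠ z in D ℓ, z ∈ S ℓ) → ∃ s, P s := by
  induction n with
  | zero => exact fun {I D S P} h _ => ⟨_, h⟩
  | succ n ih =>
    intro I D S P h hS
    obtain ⟨z, hz, hz'⟩ := ((hS 0).and_eventually h).exists
    obtain ⟨s, hs⟩ := ih (hz' hz) fun ℓ => hS ℓ.succ
    exact ⟨_, hs⟩

theorem iteratedAlmostAll_inf_principal_iff {n : ℕ} : ∀ {I : Fin n → Type x}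
    {D : ∀ ℓ, Filter (I ℓ)} {S S' : ∀ ℓ, Set (I ℓ)} {P : (∀ ℓ, I ℓ) → Prop},
    IteratedAlmostAll (fun ℓ => D ℓ ⊓ Filter.principal (S ℓ)) S' P ↔
      IteratedAlmostAll D (fun ℓ => S ℓ ∩ S' ℓ) P := by
  induction n with
  | zero => exact Iff.rfl
  | succ n ih =>
    intro I D S S' P
    simp only [IteratedAlmostAll, Filter.eventually_inf_principal, Set.mem_inter_iff, and_imp]
    exact Filter.eventually_congr (Filter.Eventually.of_forall fun z =>
      imp_congr_right fun _ => imp_congr_right fun _ => ih)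

theorem iteratedAlmostAll_map_iff {n : ℕ} : ∀ {I : Fin n → Type x} {V : Fin n → Type w}
    {D : ∀ ℓ, Filter (I ℓ)} {e : ∀ ℓ, I ℓ → V ℓ} {S : ∀ ℓ, Set (V ℓ)} {P : (∀ ℓ, V ℓ) → Prop},
    IteratedAlmostAll (fun ℓ => (D ℓ).map (e ℓ)) S P ↔
      IteratedAlmostAll D (fun ℓ => e ℓ ⁻¹' S ℓ) fun s => P fun ℓ => e ℓ (s ℓ) := by
  induction n with
  | zero =>
    intro I V D e S P
    exact iff_of_eq (congrArg P (funext fun ℓ => ℓ.elim0))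
  | succ n ih =>
    intro I V D e S P
    simp only [IteratedAlmostAll, Filter.eventually_map]
    refine Filter.eventually_congr (Filter.Eventually.of_forall fun z =>
      imp_congr_right fun _ => ih.trans (iff_of_eq (congrArg _ (funext fun s => congrArg P ?_))))
    funext ℓ
    exact Fin.cases rfl (fun ℓ => rfl) ℓ

theorem not_rectFrequently_iff {M : Type w} {n : ℕ} : ∀ {m : Fin n → ℕ}
    {D : ∀ ℓ, Filter (Fin (m ℓ) → M)} {S : ∀ ℓ, Set (Fin (m ℓ) → M)}
    {P : (∀ ℓ, Fin (m ℓ) → M) → Prop},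
    ¬ RectFrequently (fun ℓ => D ℓ ⊓ Filter.principal (S ℓ)) P ↔
      IteratedAlmostAll D S fun s => ¬ P s := by
  induction n with
  | zero => exact Iff.rfl
  | succ n ih =>
    intro m D S P
    simp only [IteratedAlmostAll, RectFrequently, Filter.not_frequently,
      Filter.eventually_inf_principal]
    exact Filter.eventually_congr (Filter.Eventually.of_forall fun z =>
      imp_congr_right fun _ => ih)

/-- In a structure without large shattered families, the truth value of a formula is constant on a
positive rectangle, in the sense of the iterated quantifier. -/
theorem exists_iteratedAlmostAll_realize_iff {L : FirstOrder.Language.{u, v}} {M : Type w}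
    [L.Structure M] [Nonempty M] (hM : BoundedShattering L M) {n : ℕ} {m : Fin n → ℕ}
    {D : ∀ ℓ, Filter (Fin (m ℓ) → M)} (hD : ∀ ℓ, (D ℓ).NeBot) {κ : Type} [Finite κ] (c : κ → M)
    (ψ : L.Formula (κ ⊕ Σ ℓ, Fin (m ℓ))) :
    ∃ S : ∀ ℓ, Set (Fin (m ℓ) → M), (∀ ℓ, ∃ᶠ z in D ℓ, z ∈ S ℓ) ∧ ∃ b : Prop,
      IteratedAlmostAll D S fun s => ψ.Realize (Sum.elim c fun q => s q.1 q.2) ↔ b := by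
  -- Over a one-point parameter space, failure of density for the sign `b` gives the opposite truth
  -- value almost everywhere on `S`.
  have h := not_forall_eventually_rectFrequently hM hD (DP := pure PUnit.unit)
    (fun _ : PUnit.{w + 1} => c) ψ
  push Not at h
  obtain ⟨b, S, hS, hb⟩ := h
  obtain ⟨-, hb⟩ := hb.exists
  rw [not_rectFrequently_iff] at hb
  exact ⟨S, hS, ¬ b = true, hb.mono (fun _ => le_rfl) fun s hs => by tauto⟩

/-- Each instance is decided inside the rectangle found so far. The reference point `s₀` ensures
that the common truth values form the type of an actual tuple. -/
theorem exists_iteratedAlmostAll_forall_iff {L : FirstOrder.Language.{u, v}} {M : Type w}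
    [L.Structure M] [Nonempty M] (hM : BoundedShattering L M) {n : ℕ} {m : Fin n → ℕ}
    {D : ∀ ℓ, Filter (Fin (m ℓ) → M)} (hD : ∀ ℓ, (D ℓ).NeBot)
    {X : Set (Σ k : ℕ, L.Formula (Fin (∑ ℓ, m ℓ) ⊕ Fin k) × (Fin k → M))} (hX : X.Finite) :
    ∃ S : ∀ ℓ, Set (Fin (m ℓ) → M), (∀ ℓ, ∃ᶠ z in D ℓ, z ∈ S ℓ) ∧
      ∃ s₀ : ∀ ℓ, Fin (m ℓ) → M, IteratedAlmostAll D S fun s => ∀ p ∈ X,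
        p.2.1.Realize (Sum.elim (concat s₀) p.2.2) ↔
          p.2.1.Realize (Sum.elim (concat s) p.2.2) := by
  induction X, hX using Set.Finite.induction_on with
  | empty =>
    refine ⟨fun _ => Set.univ, fun ℓ => ?_, fun _ _ => Classical.arbitrary M,
      IteratedAlmostAll.of_forall (by simp)⟩
    have := hD ℓ
    exact (Filter.Eventually.of_forall fun z => Set.mem_univ z).frequently
  | @insert p X _ _ ih =>
    obtain ⟨S, hS, s₀, h₀⟩ := ih
    obtain ⟨S', hS', b, hb⟩ := exists_iteratedAlmostAll_realize_iff hM
      (D := fun ℓ => D ℓ ⊓ Filter.principal (S ℓ))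
      (fun ℓ => Filter.frequently_mem_iff_neBot.1 (hS ℓ)) p.2.2
      (p.2.1.relabel (Sum.elim (fun i => Sum.inr (finSigmaFinEquiv.symm i)) Sum.inl))
    rw [iteratedAlmostAll_inf_principal_iff] at hb
    have hSS' : ∀ ℓ, ∃ᶠ z in D ℓ, z ∈ S ℓ ∩ S' ℓ := fun ℓ => by
      have := hS' ℓ
      rwa [frequently_inf_principal_iff] at this
    have key : ∀ s : ∀ ℓ, Fin (m ℓ) → M,
        Sum.elim p.2.2 (fun q : Σ ℓ, Fin (m ℓ) => s q.1 q.2) ∘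
          Sum.elim (fun i => Sum.inr (finSigmaFinEquiv.symm i)) Sum.inl =
        Sum.elim (concat s) p.2.2 := by
      intro s
      ext (i | j) <;> rfl
    simp only [Formula.realize_relabel, key] at hb
    have hand := (h₀.mono (fun ℓ => Set.inter_subset_left) fun _ hs => hs).and hb
    -- A point satisfying both the old agreement and the new decision replaces `s₀`; old instances
    -- are compared through `s₀`.
    obtain ⟨s₁, hs₁, hs₁'⟩ := hand.exists hSS'
    refine ⟨_, hSS', s₁, hand.mono (fun _ => le_rfl) fun s hs q hq => ?_⟩
    rcases Set.mem_insert_iff.1 hq with rfl | hq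
    · rw [hs₁', hs.2]
    · rw [← hs₁ q hq, hs.1 q hq]

theorem finite_instances {L : FirstOrder.Language.{u, v}} {M : Type w} {m : ℕ}
    {Δ : Set (SplitFormula L m)} (hΔ : Δ.Finite) {C : Set M} (hC : C.Finite) :
    {p : Σ k : ℕ, L.Formula (Fin m ⊕ Fin k) × (Fin k → M) |
      (⟨p.1, p.2.1⟩ : SplitFormula L m) ∈ Δ ∧ ∀ j, p.2.2 j ∈ C}.Finite := by
  refine (hΔ.biUnion fun δ _ => (Set.Finite.pi' fun _ : Fin δ.1 => hC).image
    fun c => (⟨δ.1, δ.2, c⟩ : Σ k : ℕ, L.Formula (Fin m ⊕ Fin k) × (Fin k → M))).subset ?_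
  rintro ⟨k, φ, c⟩ ⟨h, hc⟩
  exact Set.mem_biUnion h ⟨c, hc, rfl⟩

end PolarizedPartition

theorem theoremd21 {L : FirstOrder.Language.{u, v}} (T : L.Theory)
    (hT : T.IsComplete) (hdep : PolarizedPartition.IsDependent T)
    (M : Type w) [L.Structure M] [T.Model M] [Nonempty M]
    (κ : Cardinal.{x}) (hκ : κ.IsRegular) (hκ' : Cardinal.aleph0 < κ)
    (n : ℕ) (I : Fin n → Type x) (D : ∀ ℓ, Filter (I ℓ)) (hD : ∀ ℓ, (D ℓ).NeBot)
    (hDκ : ∀ ℓ : Fin n, (ℓ : ℕ) ≠ 0 → CardinalInterFilter (D ℓ) κ)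
    (m : Fin n → ℕ) (e : ∀ ℓ : Fin n, I ℓ → Fin (m ℓ) → M)
    (Δ : Set (PolarizedPartition.SplitFormula L (∑ ℓ, m ℓ))) (hΔ : Δ.Finite)
    (C : Set M) (hC : C.Finite) :
    ∃ q ∈ Set.range (PolarizedPartition.deltaType Δ C),
      ∃ S : ∀ ℓ, Set (I ℓ), (∀ ℓ, PolarizedPartition.IsPositive (D ℓ) (S ℓ)) ∧
        PolarizedPartition.IteratedAlmostAll D S fun s =>
          q = PolarizedPartition.deltaType Δ C
            (PolarizedPartition.concat fun ℓ => e ℓ (s ℓ)) := by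
  -- Pushing each `D ℓ` forward along `e ℓ` gives proper filters on tuples; positive sets return as
  -- preimages.
  obtain ⟨S, hS, s₀, h⟩ := PolarizedPartition.exists_iteratedAlmostAll_forall_iff
    (PolarizedPartition.boundedShattering_of_isDependent hT hdep M)
    (fun ℓ => (hD ℓ).map (e ℓ)) (PolarizedPartition.finite_instances hΔ hC)
  refine ⟨_, ⟨PolarizedPartition.concat s₀, rfl⟩, fun ℓ => e ℓ ⁻¹' S ℓ, hS, ?_⟩
  rw [PolarizedPartition.iteratedAlmostAll_map_iff] at h
  refine h.mono (fun _ => le_rfl) fun s hs => ?_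
  ext p
  exact and_congr_right fun h₁ => and_congr_right fun h₂ => hs p ⟨h₁, h₂⟩
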